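/- Let $N, D$ be integers with $0\le D<N$, let $L_1,\dots,L_N>0$ and $k^-<0$. Let $\mathscr S$ be the star graph with $N$ edges $e_1,\dots,e_N$ of lengths $|e_j|=L_j$ joined at one internal vertex, where $e_j$ is parametrized by $[0,L_j]$ with $x=0$ at the external vertex and $x=L_j$ at the internal vertex. Let $L^2(\mathscr S)=\prod_{j=1}^N L^2((0,L_j),\mathbb R)$ with the scalar product $(\psi,\varphi)_{L^2}=\sum_{j=1}^N\int_0^{L_j}\psi_j\varphi_j\,dx$. Consider the unbounded operator $A$ in $L^2(\mathscr S)$, $$A\psi=\big(-\partial_x^2\psi_1,\dots,-\partial_x^2\psi_D,\,-k^-\partial_x^2\psi_{D+1},\dots,-k^-\partial_x^2\psi_N\big),\qquad \psi\in D(A),$$ $$D(A)=\Big\{\psi\in\prod_{j=1}^N H^2((0,L_j),\mathbb R):\ \psi_1(0)=\dots=\psi_N(0)=0,\ \ \psi_1(L_1)=\dots=\psi_N(L_N),\ \ \sum_{j=1}^D\partial_x\psi_j(L_j)+k^-\sum_{j=D+1}^N\partial_x\psi_j(L_j)=0\Big\}.$$ Then $A$ is self-adjoint. If moreover $$|k^-|\neq\frac{D}{N-D},$$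 then $A$ has compact resolvent: its (real) resolvent set is nonempty, and $(A-\mu)^{-1}$ is a compact operator on $L^2(\mathscr S)$ for every $\mu$ in it. -/

import Mathlib

open MeasureTheory Set
open scoped ContDiff

noncomputable section

namespace StarGraph

/-- The real Hilbert space `L²(e, ℝ)` of an edge `e` of length `ℓ`, parametrized by `(0, ℓ)`. -/
abbrev EdgeL2 (ℓ : ℝ) : Type := Lp ℝ 2 (volume.restrict (Ioo (0 : ℝ) ℓ))

/-- The real Hilbert space `L²(𝒮) = ∏ⱼ L²(eⱼ, ℝ)` of the star graph whose edges have lengths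
`L j`, with the inner product `∑ⱼ ∫₀^{Lⱼ} ψⱼ φⱼ`. -/
abbrev GraphL2 {N : ℕ} (L : Fin N → ℝ) : Type := PiLp 2 (fun j => EdgeL2 (L j))

/-- `g` is the weak derivative of `u` on `(0, ℓ)`: `∫ u φ' = - ∫ g φ` for all `φ ∈ C_c^∞((0, ℓ))`. -/
def HasWeakDeriv {ℓ : ℝ} (u g : EdgeL2 ℓ) : Prop :=
  ∀ φ : ℝ → ℝ, ContDiff ℝ ∞ φ → HasCompactSupport φ → tsupport φ ⊆ Ioo 0 ℓ →
    ∫ x in Ioo 0 ℓ, u x * deriv φ x = - ∫ x in Ioo 0 ℓ, g x * φ x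

/-- `u ∈ H¹(0, ℓ)`. -/
def MemH1 {ℓ : ℝ} (u : EdgeL2 ℓ) : Prop := ∃ g : EdgeL2 ℓ, HasWeakDeriv u g

open Classical in
/-- The weak derivative of `u ∈ H¹(0, ℓ)` (and `0` if `u` is not in `H¹(0, ℓ)`). -/
def weakDeriv {ℓ : ℝ} (u : EdgeL2 ℓ) : EdgeL2 ℓ :=
  if h : MemH1 u then h.choose else 0

/-- `u ∈ H²(0, ℓ)`: both `u` and its weak derivative lie in `H¹(0, ℓ)`. -/
def MemH2 {ℓ : ℝ} (u : EdgeL2 ℓ) : Prop := MemH1 u ∧ MemH1 (weakDeriv u)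

/-- The class `u` has a representative that is continuous on `[0, ℓ]` and takes the value `c`
at the point `x`. For `u ∈ H¹(0, ℓ)` such a representative exists, and this is the meaning of
`u(x) = c`. -/
def HasValueAt {ℓ : ℝ} (u : EdgeL2 ℓ) (x c : ℝ) : Prop :=
  ∃ v : ℝ → ℝ, ContinuousOn v (Icc 0 ℓ) ∧ u =ᵐ[volume.restrict (Ioo 0 ℓ)] v ∧ v x = c

/-! ### Basic facts needed for the operator to be well defined -/

theorem testIntegrable {ℓ : ℝ} (u : EdgeL2 ℓ) {φ : ℝ → ℝ} (hφ : Continuous φ)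
    (hc : HasCompactSupport φ) :
    Integrable (fun x => u x * φ x) (volume.restrict (Ioo 0 ℓ)) :=
  MemLp.integrable_mul (p := 2) (q := 2) (Lp.memLp u)
    ((hφ.memLp_of_hasCompactSupport hc).restrict _)

theorem HasWeakDeriv.unique {ℓ : ℝ} {u g h : EdgeL2 ℓ} (hg : HasWeakDeriv u g)
    (hh : HasWeakDeriv u h) : g = h := by
  have hgh : ∀ᵐ x ∂(volume : Measure ℝ), x ∈ Ioo 0 ℓ → (g x - h x) = 0 := by
    apply isOpen_Ioo.ae_eq_zero_of_integral_contDiff_smul_eq_zero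
    · have h1 : IntegrableOn (fun x => g x - h x) (Ioo 0 ℓ) volume :=
        ((Lp.memLp g).integrable (by norm_num)).sub ((Lp.memLp h).integrable (by norm_num))
      exact h1.locallyIntegrableOn
    · intro φ h1 h2 h3
      have e1 := hg φ h1 h2 h3
      have e2 := hh φ h1 h2 h3
      have e3 : ∫ x in Ioo 0 ℓ, (g x - h x) * φ x = 0 := by
        simp_rw [sub_mul]
        rw [integral_sub (testIntegrable g h1.continuous h2) (testIntegrable h h1.continuous h2)]
        linarith
      rw [← setIntegral_eq_integral_of_forall_compl_eq_zero (s := Ioo 0 ℓ)]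
      · refine Eq.trans ?_ e3
        refine integral_congr_ae (Filter.Eventually.of_forall fun x => ?_)
        simp [mul_comm]
      · intro x hx
        have : φ x = 0 := image_eq_zero_of_notMem_tsupport fun hx' => hx (h3 hx')
        simp [this]
  apply Lp.ext
  filter_upwards [(ae_restrict_iff' measurableSet_Ioo).2 hgh] with x hx
  linarith

theorem HasWeakDeriv.memH1 {ℓ : ℝ} {u g : EdgeL2 ℓ} (h : HasWeakDeriv u g) : MemH1 u := ⟨g, h⟩

theorem MemH1.hasWeakDeriv {ℓ : ℝ} {u : EdgeL2 ℓ} (h : MemH1 u) :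
    HasWeakDeriv u (weakDeriv u) := by
  rw [weakDeriv, dif_pos h]
  exact h.choose_spec

theorem HasWeakDeriv.weakDeriv_eq {ℓ : ℝ} {u g : EdgeL2 ℓ} (h : HasWeakDeriv u g) :
    weakDeriv u = g :=
  h.memH1.hasWeakDeriv.unique h

theorem hasWeakDeriv_zero {ℓ : ℝ} : HasWeakDeriv (0 : EdgeL2 ℓ) 0 := by
  intro φ _ _ _
  have h0 := Lp.coeFn_zero ℝ 2 (volume.restrict (Ioo (0 : ℝ) ℓ))
  have h1 : ∀ f : ℝ → ℝ, ∫ x in Ioo 0 ℓ, (0 : EdgeL2 ℓ) x * f x = 0 := by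
    intro f
    apply integral_eq_zero_of_ae
    filter_upwards [h0] with x hx
    rw [hx]
    simp
  rw [h1, h1, neg_zero]

theorem HasWeakDeriv.add {ℓ : ℝ} {u v g h : EdgeL2 ℓ} (hu : HasWeakDeriv u g)
    (hv : HasWeakDeriv v h) : HasWeakDeriv (u + v) (g + h) := by
  intro φ h1 h2 h3
  have key : ∀ (a b : EdgeL2 ℓ) (f : ℝ → ℝ), Continuous f → HasCompactSupport f →
      ∫ x in Ioo 0 ℓ, (a + b) x * f x
        = (∫ x in Ioo 0 ℓ, a x * f x) + ∫ x in Ioo 0 ℓ, b x * f x := by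
    intro a b f hf hfc
    rw [← integral_add (testIntegrable a hf hfc) (testIntegrable b hf hfc)]
    apply integral_congr_ae
    filter_upwards [Lp.coeFn_add a b] with x hx
    rw [hx, Pi.add_apply, add_mul]
  rw [key _ _ _ (h1.continuous_deriv (by simp)) h2.deriv, key _ _ _ h1.continuous h2,
    hu φ h1 h2 h3, hv φ h1 h2 h3, neg_add]

theorem HasWeakDeriv.smul {ℓ : ℝ} {u g : EdgeL2 ℓ} (c : ℝ) (hu : HasWeakDeriv u g) :
    HasWeakDeriv (c • u) (c • g) := by
  intro φ h1 h2 h3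
  have key : ∀ (a : EdgeL2 ℓ) (f : ℝ → ℝ),
      ∫ x in Ioo 0 ℓ, (c • a) x * f x = c * ∫ x in Ioo 0 ℓ, a x * f x := by
    intro a f
    rw [← integral_const_mul]
    apply integral_congr_ae
    filter_upwards [Lp.coeFn_smul c a] with x hx
    rw [hx, Pi.smul_apply, smul_eq_mul, mul_assoc]
  rw [key, key, hu φ h1 h2 h3, mul_neg]

theorem MemH1.weakDeriv_add {ℓ : ℝ} {u v : EdgeL2 ℓ} (hu : MemH1 u) (hv : MemH1 v) :
    weakDeriv (u + v) = weakDeriv u + weakDeriv v :=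
  (hu.hasWeakDeriv.add hv.hasWeakDeriv).weakDeriv_eq

theorem MemH1.weakDeriv_smul {ℓ : ℝ} {u : EdgeL2 ℓ} (c : ℝ) (hu : MemH1 u) :
    weakDeriv (c • u) = c • weakDeriv u :=
  (hu.hasWeakDeriv.smul c).weakDeriv_eq

theorem weakDeriv_zero {ℓ : ℝ} : weakDeriv (0 : EdgeL2 ℓ) = 0 := hasWeakDeriv_zero.weakDeriv_eq

theorem memH2_zero {ℓ : ℝ} : MemH2 (0 : EdgeL2 ℓ) := by
  refine ⟨hasWeakDeriv_zero.memH1, ?_⟩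
  rw [weakDeriv_zero]
  exact hasWeakDeriv_zero.memH1

theorem MemH2.add {ℓ : ℝ} {u v : EdgeL2 ℓ} (hu : MemH2 u) (hv : MemH2 v) : MemH2 (u + v) := by
  refine ⟨(hu.1.hasWeakDeriv.add hv.1.hasWeakDeriv).memH1, ?_⟩
  rw [hu.1.weakDeriv_add hv.1]
  exact (hu.2.hasWeakDeriv.add hv.2.hasWeakDeriv).memH1

theorem MemH2.smul {ℓ : ℝ} {u : EdgeL2 ℓ} (c : ℝ) (hu : MemH2 u) : MemH2 (c • u) := by
  refine ⟨(hu.1.hasWeakDeriv.smul c).memH1, ?_⟩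
  rw [hu.1.weakDeriv_smul c]
  exact (hu.2.hasWeakDeriv.smul c).memH1

theorem hasValueAt_zero {ℓ : ℝ} (x : ℝ) : HasValueAt (0 : EdgeL2 ℓ) x 0 :=
  ⟨0, continuousOn_const, Lp.coeFn_zero ℝ 2 _, rfl⟩

theorem HasValueAt.add {ℓ x c d : ℝ} {u v : EdgeL2 ℓ} (hu : HasValueAt u x c)
    (hv : HasValueAt v x d) : HasValueAt (u + v) x (c + d) := by
  obtain ⟨a, ha, hua, rfl⟩ := hu
  obtain ⟨b, hb, hvb, rfl⟩ := hv
  exact ⟨a + b, ha.add hb, (Lp.coeFn_add u v).trans (hua.add hvb), rfl⟩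

theorem HasValueAt.smul {ℓ x c : ℝ} {u : EdgeL2 ℓ} (r : ℝ) (hu : HasValueAt u x c) :
    HasValueAt (r • u) x (r * c) := by
  obtain ⟨a, ha, hua, rfl⟩ := hu
  exact ⟨r • a, ha.const_smul r, (Lp.coeFn_smul r u).trans (hua.const_smul r), rfl⟩

/-! ### The operator -/

/-- The operator domain: `ψ ∈ ∏ⱼ H²(0, Lⱼ)` with `ψⱼ(0) = 0` for all `j`, with a common value
`ψ₁(L₁) = … = ψ_N(L_N)` at the internal vertex, and with `∑ⱼ kⱼ ψⱼ'(Lⱼ) = 0`. -/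
def starDomain {N : ℕ} (L k : Fin N → ℝ) : Submodule ℝ (GraphL2 L) where
  carrier := {ψ |
    (∀ j, MemH2 (ψ j)) ∧
    (∀ j, HasValueAt (ψ j) 0 0) ∧
    (∃ c : ℝ, ∀ j, HasValueAt (ψ j) (L j) c) ∧
    (∃ d : Fin N → ℝ, (∀ j, HasValueAt (weakDeriv (ψ j)) (L j) (d j)) ∧ ∑ j, k j * d j = 0)}
  zero_mem' := by
    refine ⟨fun _ => memH2_zero, fun _ => hasValueAt_zero _, ⟨0, fun _ => hasValueAt_zero _⟩,
      0, fun j => ?_, by simp⟩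
    have h : weakDeriv ((0 : GraphL2 L) j) = 0 := weakDeriv_zero
    rw [h]
    exact hasValueAt_zero _
  add_mem' := by
    rintro ψ φ ⟨h1, h2, ⟨c, h3⟩, d, h4, h5⟩ ⟨h1', h2', ⟨c', h3'⟩, d', h4', h5'⟩
    refine ⟨fun j => (h1 j).add (h1' j), fun j => ?_, ⟨c + c', fun j => (h3 j).add (h3' j)⟩,
      d + d', fun j => ?_, ?_⟩
    · simpa using (h2 j).add (h2' j)
    · have h : weakDeriv ((ψ + φ) j) = weakDeriv (ψ j) + weakDeriv (φ j) :=
        (h1 j).1.weakDeriv_add (h1' j).1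
      rw [h]
      exact (h4 j).add (h4' j)
    · simp [mul_add, Finset.sum_add_distrib, h5, h5']
  smul_mem' := by
    rintro r ψ ⟨h1, h2, ⟨c, h3⟩, d, h4, h5⟩
    refine ⟨fun j => (h1 j).smul r, fun j => ?_, ⟨r * c, fun j => (h3 j).smul r⟩,
      r • d, fun j => ?_, ?_⟩
    · simpa using (h2 j).smul r
    · have h : weakDeriv ((r • ψ) j) = r • weakDeriv (ψ j) := (h1 j).1.weakDeriv_smul r
      rw [h]
      exact (h4 j).smul r
    · simp only [Pi.smul_apply, smul_eq_mul, mul_left_comm _ r]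
      rw [← Finset.mul_sum, h5, mul_zero]

/-- The unbounded operator `ψ ↦ (-kⱼ ψⱼ'')ⱼ` in `L²(𝒮)` with domain `starDomain L k`. -/
def starOperator {N : ℕ} (L k : Fin N → ℝ) : GraphL2 L →ₗ.[ℝ] GraphL2 L where
  domain := starDomain L k
  toFun :=
    { toFun := fun ψ =>
        WithLp.toLp 2 (fun j => -(k j) • weakDeriv (weakDeriv ((ψ : GraphL2 L) j)))
      map_add' := by
        intro ψ φ
        ext1 j
        have h : weakDeriv (weakDeriv (((ψ : GraphL2 L) + (φ : GraphL2 L)) j))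
            = weakDeriv (weakDeriv ((ψ : GraphL2 L) j))
              + weakDeriv (weakDeriv ((φ : GraphL2 L) j)) := by
          rw [PiLp.add_apply, (ψ.2.1 j).1.weakDeriv_add (φ.2.1 j).1,
            (ψ.2.1 j).2.weakDeriv_add (φ.2.1 j).2]
        change -(k j) • weakDeriv (weakDeriv (((ψ : GraphL2 L) + (φ : GraphL2 L)) j)) =
          -(k j) • weakDeriv (weakDeriv ((ψ : GraphL2 L) j))
            + -(k j) • weakDeriv (weakDeriv ((φ : GraphL2 L) j))
        rw [h, smul_add]
      map_smul' := by
        intro r ψ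
        ext1 j
        have h : weakDeriv (weakDeriv ((r • (ψ : GraphL2 L)) j))
            = r • weakDeriv (weakDeriv ((ψ : GraphL2 L) j)) := by
          rw [PiLp.smul_apply, (ψ.2.1 j).1.weakDeriv_smul r, (ψ.2.1 j).2.weakDeriv_smul r]
        change -(k j) • weakDeriv (weakDeriv ((r • (ψ : GraphL2 L)) j)) =
          r • (-(k j) • weakDeriv (weakDeriv ((ψ : GraphL2 L) j)))
        rw [h, smul_comm] }

/-- Two-phase conductivities: `1` on the first `D` edges and `kneg` on the other `N - D`. -/
def twoPhase (N D : ℕ) (kneg : ℝ) : Fin N → ℝ :=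
  fun j => if (j : ℕ) < D then 1 else kneg

/-- The bounded operator `R` is the resolvent `(A - μ)⁻¹`, i.e. a two-sided inverse of
`A - μ : D(A) → E`; such an `R` exists exactly when `μ` is in the resolvent set of `A`. -/
def IsResolventAt {E : Type*} [NormedAddCommGroup E] [NormedSpace ℝ E]
    (A : E →ₗ.[ℝ] E) (μ : ℝ) (R : E →L[ℝ] E) : Prop :=
  (∀ f : E, ∃ h : R f ∈ A.domain, A ⟨R f, h⟩ - μ • R f = f) ∧
  (∀ u : A.domain, R (A u - μ • (u : E)) = u)

/-- `A` has compact resolvent: its resolvent set is nonempty, and `(A - μ)⁻¹` is a compact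
operator for every `μ` in the resolvent set. -/
def HasCompactResolvent {E : Type*} [NormedAddCommGroup E] [NormedSpace ℝ E]
    (A : E →ₗ.[ℝ] E) : Prop :=
  (∃ (μ : ℝ) (R : E →L[ℝ] E), IsResolventAt A μ R) ∧
  ∀ (μ : ℝ) (R : E →L[ℝ] E), IsResolventAt A μ R → IsCompactOperator R

end StarGraph

end

/-!
The argument applies to `A = starOperator L k` for arbitrary nonzero real coefficients `k`.

The calculus on an edge rests on the Volterra operator `V f (x) = ∫₀ˣ f` on `L²(0, ℓ)`. It is
compact, being a norm limit of finite-rank operators (`isCompactOperator_volterra`), `f` is the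
weak derivative of `V f`, and by the du Bois-Reymond lemma every `u ∈ H¹(0, ℓ)` is `V u'` plus a
constant (`HasWeakDeriv.eq_volterra_add`). Integration by parts then gives
`⟪A ψ, φ⟫ = ∑ⱼ kⱼ ⟪ψⱼ', φⱼ'⟫` on the domain, so that `A` is symmetric (`inner_starOperator`).

A symmetric operator `A` for which `A - μ` is onto for one real `μ` is self-adjoint
(`isSelfAdjoint_of_symmetric_of_surjective`), so everything reduces to finding a real `μ` and a
compact right inverse of `A - μ`; by the resolvent identity, all other resolvents are then
compact too. Let `G` be the compact Green operator of the edges decoupled by Dirichlet conditions, and let `hat`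
be the function that is linear on each edge and equal to `1` at the internal vertex. The ansatz
`u = G g + c • hat` meets every condition of the domain except that on the fluxes, and solves
`A u - μ u = f` as soon as `(1 - μ G) g = f + μ c • hat` and a scalar linear equation for `c`
holds. Its leading coefficient is `∑ⱼ kⱼ / Lⱼ - μ flux ((1 - μ G)⁻¹ hat)`. If `∑ⱼ kⱼ / Lⱼ ≠ 0`, then
`μ = 0` will do; otherwise, since `flux hat = ∑ⱼ Lⱼ / 3 > 0`, every sufficiently small `μ ≠ 0` will
(`exists_neumann_inverse`).
-/

noncomputable section

namespace StarGraph

/-! ### Primitives of `L²` functions on an edge -/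

/-- The extension of (a representative of) `f ∈ L²(0, ℓ)` to `ℝ` by zero. -/
def zeroExt {ℓ : ℝ} (f : EdgeL2 ℓ) : ℝ → ℝ := (Ioo 0 ℓ).indicator f

/-- The primitive `x ↦ ∫₀ˣ f` of `f ∈ L²(0, ℓ)`, as a continuous function on `ℝ`. -/
def primitive {ℓ : ℝ} (f : EdgeL2 ℓ) (x : ℝ) : ℝ := ∫ s in (0 : ℝ)..x, zeroExt f s

/-- The constant function `1` in `L²(0, ℓ)`. -/
def one (ℓ : ℝ) : EdgeL2 ℓ := Lp.const 2 _ 1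

section
variable {ℓ : ℝ}

theorem integrable_zeroExt (f : EdgeL2 ℓ) : Integrable (zeroExt f) :=
  (integrable_indicator_iff measurableSet_Ioo).2 ((Lp.memLp f).integrable (by norm_num))

theorem zeroExt_ae_eq (f : EdgeL2 ℓ) : zeroExt f =ᵐ[volume.restrict (Ioo 0 ℓ)] f :=
  indicator_ae_eq_restrict measurableSet_Ioo

@[simp] theorem primitive_zero_right (f : EdgeL2 ℓ) : primitive f 0 = 0 := by
  simp [primitive]

theorem continuous_primitive (f : EdgeL2 ℓ) : Continuous (primitive f) :=
  intervalIntegral.continuous_primitive (fun _ _ => (integrable_zeroExt f).intervalIntegrable) 0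

theorem primitive_sub_eq_inner (f : EdgeL2 ℓ) {x y : ℝ} (hxy : x ≤ y) :
    primitive f y - primitive f x =
      inner ℝ (indicatorConstLp 2 (measurableSet_Ioc (a := x) (b := y))
        (measure_ne_top (volume.restrict (Ioo 0 ℓ)) _) (1 : ℝ)) f := by
  rw [L2.inner_indicatorConstLp_one, primitive, primitive,
    intervalIntegral.integral_interval_sub_left (integrable_zeroExt f).intervalIntegrable
      (integrable_zeroExt f).intervalIntegrable, intervalIntegral.integral_of_le hxy]
  rw [Measure.restrict_restrict measurableSet_Ioc, zeroExt, setIntegral_indicator measurableSet_Ioo]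

/-- The Cauchy–Schwarz inequality: primitives of `L²` functions are `1/2`-Hölder continuous. -/
theorem abs_primitive_sub_le (f : EdgeL2 ℓ) {x y : ℝ} (hxy : x ≤ y) :
    |primitive f y - primitive f x| ≤ √(y - x) * ‖f‖ := by
  rw [primitive_sub_eq_inner f hxy]
  refine (abs_real_inner_le_norm _ _).trans ?_
  gcongr
  rw [norm_indicatorConstLp (by norm_num) (by norm_num), norm_one, one_mul, Real.sqrt_eq_rpow]
  rw [ENNReal.toReal_ofNat]
  apply Real.rpow_le_rpow measureReal_nonneg _ (by norm_num)
  calc (volume.restrict (Ioo 0 ℓ)).real (Ioc x y) ≤ volume.real (Ioc x y) :=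
        ENNReal.toReal_mono (by simp) (Measure.restrict_apply_le _ _)
    _ = y - x := by simp [hxy]

theorem abs_primitive_le (f : EdgeL2 ℓ) {x : ℝ} (hx : x ∈ Ioo 0 ℓ) :
    |primitive f x| ≤ √ℓ * ‖f‖ := by
  have h := abs_primitive_sub_le f hx.1.le
  rw [primitive_zero_right, sub_zero, sub_zero] at h
  refine h.trans ?_
  gcongr
  exact hx.2.le

theorem memLp_primitive (f : EdgeL2 ℓ) :
    MemLp (primitive f) 2 (volume.restrict (Ioo 0 ℓ)) :=
  MemLp.of_bound (continuous_primitive f).aestronglyMeasurable (√ℓ * ‖f‖)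
    ((ae_restrict_iff' measurableSet_Ioo).2 (.of_forall fun _ hx => abs_primitive_le f hx))

theorem primitive_congr {f : EdgeL2 ℓ} {g : ℝ → ℝ} (h : f =ᵐ[volume.restrict (Ioo 0 ℓ)] g)
    {x : ℝ} (hx : x ∈ Icc 0 ℓ) : primitive f x = ∫ s in (0 : ℝ)..x, g s := by
  apply intervalIntegral.integral_congr_ae
  have h1 : ∀ᵐ s, s ≠ ℓ := by simp [ae_iff]
  filter_upwards [(ae_restrict_iff' measurableSet_Ioo).1 h, h1] with s hs hsℓ hsx
  rw [uIoc_of_le hx.1] at hsx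
  have hs' : s ∈ Ioo 0 ℓ := ⟨hsx.1, lt_of_le_of_ne (hsx.2.trans hx.2) hsℓ⟩
  rw [zeroExt, indicator_of_mem hs', hs hs']

theorem primitive_add (f g : EdgeL2 ℓ) (x : ℝ) :
    primitive (f + g) x = primitive f x + primitive g x := by
  rw [primitive, primitive, primitive, ← intervalIntegral.integral_add
    (integrable_zeroExt f).intervalIntegrable (integrable_zeroExt g).intervalIntegrable]
  apply intervalIntegral.integral_congr_ae
  filter_upwards [(ae_restrict_iff' measurableSet_Ioo).1 (Lp.coeFn_add f g)] with s hs _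
  by_cases h : s ∈ Ioo 0 ℓ
  · simp only [zeroExt, indicator_of_mem h, hs h, Pi.add_apply]
  · simp [zeroExt, h]

theorem primitive_smul (c : ℝ) (f : EdgeL2 ℓ) (x : ℝ) :
    primitive (c • f) x = c * primitive f x := by
  rw [primitive, primitive, ← intervalIntegral.integral_const_mul]
  apply intervalIntegral.integral_congr_ae
  filter_upwards [(ae_restrict_iff' measurableSet_Ioo).1 (Lp.coeFn_smul c f)] with s hs _
  by_cases h : s ∈ Ioo 0 ℓ
  · simp [zeroExt, h, hs h]
  · simp [zeroExt, h]

/-- The Volterra operator `f ↦ (x ↦ ∫₀ˣ f)` on `L²(0, ℓ)`. -/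
def volterra (ℓ : ℝ) : EdgeL2 ℓ →L[ℝ] EdgeL2 ℓ :=
  LinearMap.mkContinuous
    { toFun := fun f => (memLp_primitive f).toLp _
      map_add' := fun f g => by
        rw [← MemLp.toLp_add]
        exact MemLp.toLp_congr _ _ (.of_forall fun x => primitive_add f g x)
      map_smul' := fun c f => by
        rw [RingHom.id_apply, ← MemLp.toLp_const_smul]
        exact MemLp.toLp_congr _ _ (.of_forall fun x => primitive_smul c f x) }
    ((measureUnivNNReal (volume.restrict (Ioo 0 ℓ)) : ℝ) ^ (ENNReal.toReal 2)⁻¹ * √ℓ)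
    (fun f => by
      rw [mul_assoc]
      refine Lp.norm_le_of_ae_bound (by positivity) ?_
      filter_upwards [(memLp_primitive f).coeFn_toLp, ae_restrict_mem measurableSet_Ioo]
        with x hx hx'
      rw [LinearMap.coe_mk, AddHom.coe_mk, hx]
      exact abs_primitive_le f hx')

theorem volterra_ae_eq (f : EdgeL2 ℓ) :
    volterra ℓ f =ᵐ[volume.restrict (Ioo 0 ℓ)] primitive f :=
  (memLp_primitive f).coeFn_toLp

theorem one_ae_eq (ℓ : ℝ) : one ℓ =ᵐ[volume.restrict (Ioo 0 ℓ)] fun _ => 1 :=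
  Lp.coeFn_const _ _ _

theorem inner_one_left (hℓ : 0 ≤ ℓ) (f : EdgeL2 ℓ) : inner ℝ (one ℓ) f = primitive f ℓ := by
  rw [one, ← indicatorConstLp_univ, L2.inner_indicatorConstLp_one, Measure.restrict_univ,
    primitive_congr (g := f) (ae_eq_refl _) ⟨hℓ, le_rfl⟩, intervalIntegral.integral_of_le hℓ,
    integral_Ioc_eq_integral_Ioo]

theorem primitive_one {x : ℝ} (hx : x ∈ Icc 0 ℓ) : primitive (one ℓ) x = x := by
  rw [primitive_congr (one_ae_eq ℓ) hx]
  simp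

theorem primitive_volterra_one {x : ℝ} (hx : x ∈ Icc 0 ℓ) :
    primitive (volterra ℓ (one ℓ)) x = x ^ 2 / 2 := by
  have h : volterra ℓ (one ℓ) =ᵐ[volume.restrict (Ioo 0 ℓ)] fun x => x := by
    filter_upwards [volterra_ae_eq (one ℓ), ae_restrict_mem measurableSet_Ioo] with x hx hx'
    rw [hx, primitive_one (Ioo_subset_Icc_self hx')]
  rw [primitive_congr h hx]
  simp

theorem primitive_volterra_volterra_one {x : ℝ} (hx : x ∈ Icc 0 ℓ) :
    primitive (volterra ℓ (volterra ℓ (one ℓ))) x = x ^ 3 / 6 := by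
  have h : volterra ℓ (volterra ℓ (one ℓ)) =ᵐ[volume.restrict (Ioo 0 ℓ)] fun x => x ^ 2 / 2 := by
    filter_upwards [volterra_ae_eq (volterra ℓ (one ℓ)), ae_restrict_mem measurableSet_Ioo]
      with x hx hx'
    rw [hx, primitive_volterra_one (Ioo_subset_Icc_self hx')]
  rw [primitive_congr h hx]
  simp
  ring

theorem absolutelyContinuous_primitive (f : EdgeL2 ℓ) :
    AbsolutelyContinuousOnInterval (primitive f) 0 ℓ :=
  (integrable_zeroExt f).intervalIntegrable.absolutelyContinuousOnInterval_intervalIntegral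
    left_mem_uIcc

theorem ae_hasDerivAt_primitive (f : EdgeL2 ℓ) :
    ∀ᵐ x ∂volume.restrict (Ioo 0 ℓ), HasDerivAt (primitive f) (f x) x := by
  filter_upwards [ae_restrict_of_ae
    (LocallyIntegrable.ae_hasDerivAt_integral (integrable_zeroExt f).locallyIntegrable),
    zeroExt_ae_eq f] with x hx hx'
  exact hx' ▸ hx 0

/-- Integration by parts for a primitive against an absolutely continuous function. -/
theorem integral_primitive_mul_deriv (hℓ : 0 ≤ ℓ) (f : EdgeL2 ℓ) {φ φ' : ℝ → ℝ}
    (hφ : AbsolutelyContinuousOnInterval φ 0 ℓ)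
    (hφ' : ∀ᵐ x ∂volume.restrict (Ioo 0 ℓ), HasDerivAt φ (φ' x) x) :
    ∫ x in Ioo 0 ℓ, (f x * φ x + volterra ℓ f x * φ' x) = primitive f ℓ * φ ℓ := by
  have h0 : AbsolutelyContinuousOnInterval (primitive f) 0 ℓ := absolutelyContinuous_primitive f
  have h1 := h0.integral_deriv_mul_eq_sub hφ
  rw [primitive_zero_right, zero_mul, sub_zero, intervalIntegral.integral_of_le hℓ,
    integral_Ioc_eq_integral_Ioo] at h1
  rw [← h1]
  apply integral_congr_ae
  filter_upwards [ae_hasDerivAt_primitive f, hφ', volterra_ae_eq f] with x e1 e2 e3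
  rw [e1.deriv, e2.deriv, e3]

/-- `V + V* = 1 ⊗ 1` for the Volterra operator `V`. -/
theorem inner_volterra_add_inner_volterra (hℓ : 0 ≤ ℓ) (f g : EdgeL2 ℓ) :
    inner ℝ f (volterra ℓ g) + inner ℝ (volterra ℓ f) g = primitive f ℓ * primitive g ℓ := by
  rw [L2.inner_def, L2.inner_def, ← integral_add (L2.integrable_inner _ _)
    (L2.integrable_inner _ _)]
  have h0 : AbsolutelyContinuousOnInterval (primitive g) 0 ℓ := absolutelyContinuous_primitive g
  rw [← integral_primitive_mul_deriv hℓ f h0 (φ' := g)]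
  · apply integral_congr_ae
    filter_upwards [volterra_ae_eq g] with x hx
    simp only [RCLike.inner_apply, conj_trivial, hx]
    ring
  · exact ae_hasDerivAt_primitive g

end

/-! ### Compactness of the Volterra operator -/

section
variable {ℓ : ℝ}

/-- An operator of rank at most one is compact. -/
theorem isCompactOperator_smulRight {E F : Type*} [NormedAddCommGroup E] [NormedSpace ℝ E]
    [NormedAddCommGroup F] [NormedSpace ℝ F] (φ : E →L[ℝ] ℝ) (v : F) :
    IsCompactOperator (φ.smulRight v) :=
  (isCompactOperator_of_locallyCompactSpace_rng
    (ContinuousLinearMap.toSpanSingleton ℝ v)).comp_clm φ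

theorem isCompactOperator_sum {ι E F : Type*} [NormedAddCommGroup E] [NormedSpace ℝ E]
    [NormedAddCommGroup F] [NormedSpace ℝ F] (s : Finset ι) (T : ι → E →L[ℝ] F)
    (h : ∀ i ∈ s, IsCompactOperator (T i)) : IsCompactOperator (∑ i ∈ s, T i : E →L[ℝ] F) :=
  (compactOperator (RingHom.id ℝ) E F).sum_mem (t := s) (f := T) h

/-- The finite-rank approximation of the Volterra operator that replaces the primitive of `f` by
its values at the nodes `i ℓ / n`. -/
def stepVolterra (ℓ : ℝ) (n : ℕ) : EdgeL2 ℓ →L[ℝ] EdgeL2 ℓ :=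
  ∑ i ∈ Finset.range n,
    (innerSL ℝ (indicatorConstLp 2 (measurableSet_Ioc (a := 0) (b := i * (ℓ / n)))
      (measure_ne_top (volume.restrict (Ioo 0 ℓ)) _) (1 : ℝ))).smulRight
    (indicatorConstLp 2 (measurableSet_Ico (a := i * (ℓ / n)) (b := (i + 1) * (ℓ / n)))
      (measure_ne_top (volume.restrict (Ioo 0 ℓ)) _) (1 : ℝ))

theorem coeFn_sum {ι : Type*} (s : Finset ι) (u : ι → EdgeL2 ℓ) :
    (∑ i ∈ s, u i : EdgeL2 ℓ) =ᵐ[volume.restrict (Ioo 0 ℓ)] fun x => ∑ i ∈ s, u i x := by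
  classical
  induction s using Finset.induction_on with
  | empty => exact Lp.coeFn_zero ℝ 2 _
  | insert a s ha ih =>
    rw [Finset.sum_insert ha]
    filter_upwards [Lp.coeFn_add (u a) (∑ i ∈ s, u i), ih] with x h1 h2
    rw [h1, Pi.add_apply, h2, Finset.sum_insert ha]

/-- The value of `stepVolterra` at `x` is the primitive at the last node that is at most `x`. -/
theorem stepVolterra_ae_eq (hℓ : 0 < ℓ) {n : ℕ} (hn : 0 < n) (f : EdgeL2 ℓ) :
    ∀ᵐ x ∂volume.restrict (Ioo 0 ℓ),
      stepVolterra ℓ n f x = primitive f (⌊x / (ℓ / n)⌋₊ * (ℓ / n)) := by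
  have hn' : (0 : ℝ) < n := by exact_mod_cast hn
  have hh : 0 < ℓ / n := by positivity
  have h2 : ∀ᵐ x ∂volume.restrict (Ioo 0 ℓ), ∀ i : ℕ,
      (indicatorConstLp 2 (measurableSet_Ico (a := i * (ℓ / n)) (b := (i + 1) * (ℓ / n)))
        (measure_ne_top (volume.restrict (Ioo 0 ℓ)) _) (1 : ℝ)) x =
      (Ico (i * (ℓ / n)) ((i + 1) * (ℓ / n))).indicator (fun _ => (1 : ℝ)) x :=
    ae_all_iff.2 fun i => indicatorConstLp_coeFn
  have h3 : ∀ᵐ x ∂volume.restrict (Ioo 0 ℓ), ∀ i : ℕ,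
      (primitive f (i * (ℓ / n)) •
        (indicatorConstLp 2 (measurableSet_Ico (a := i * (ℓ / n)) (b := (i + 1) * (ℓ / n)))
        (measure_ne_top (volume.restrict (Ioo 0 ℓ)) _) (1 : ℝ)) : EdgeL2 ℓ) x =
      primitive f (i * (ℓ / n)) *
        (indicatorConstLp 2 (measurableSet_Ico (a := i * (ℓ / n)) (b := (i + 1) * (ℓ / n)))
        (measure_ne_top (volume.restrict (Ioo 0 ℓ)) _) (1 : ℝ)) x :=
    ae_all_iff.2 fun i => Lp.coeFn_smul _ _
  have h1 : stepVolterra ℓ n f = ∑ i ∈ Finset.range n, primitive f (i * (ℓ / n)) •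
      (indicatorConstLp 2 (measurableSet_Ico (a := i * (ℓ / n)) (b := (i + 1) * (ℓ / n)))
      (measure_ne_top (volume.restrict (Ioo 0 ℓ)) _) (1 : ℝ)) := by
    rw [stepVolterra, _root_.sum_apply]
    refine Finset.sum_congr rfl fun i _ => ?_
    rw [ContinuousLinearMap.smulRight_apply, innerSL_apply_apply,
      ← primitive_sub_eq_inner f (by positivity), primitive_zero_right, sub_zero]
  rw [h1]
  filter_upwards [coeFn_sum (Finset.range n) _, h2, h3, ae_restrict_mem measurableSet_Ioo]
    with x e1 e2 e3 hx
  rw [e1]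
  simp only [e3, e2]
  -- Exactly one of the intervals `[i ℓ / n, (i + 1) ℓ / n)` contains `x`.
  rw [Finset.sum_eq_single ⌊x / (ℓ / n)⌋₊]
  · rw [indicator_of_mem, mul_one]
    exact ⟨(le_div_iff₀ hh).1 (Nat.floor_le (div_nonneg hx.1.le hh.le)),
      (div_lt_iff₀ hh).1 (Nat.lt_floor_add_one _)⟩
  · intro i _ hi
    rw [indicator_of_notMem, mul_zero]
    intro hxi
    apply hi
    rw [eq_comm, Nat.floor_eq_iff (div_nonneg hx.1.le hh.le)]
    exact ⟨(le_div_iff₀ hh).2 hxi.1, (div_lt_iff₀ hh).2 hxi.2⟩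
  · intro hi
    exfalso
    apply hi
    rw [Finset.mem_range, Nat.floor_lt (div_nonneg hx.1.le hh.le), div_lt_iff₀ hh]
    rw [mul_div_cancel₀ _ hn'.ne']
    exact hx.2

theorem isCompactOperator_volterra (hℓ : 0 < ℓ) : IsCompactOperator (volterra ℓ) := by
  set M : ℝ := (measureUnivNNReal (volume.restrict (Ioo 0 ℓ)) : ℝ) ^ (ENNReal.toReal 2)⁻¹
  refine isCompactOperator_of_tendsto (l := Filter.atTop) (F := stepVolterra ℓ) ?_ ?_
  · rw [tendsto_iff_norm_sub_tendsto_zero]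
    have hlim : Filter.Tendsto (fun n : ℕ => M * √(ℓ / n)) Filter.atTop (nhds 0) := by
      have h := ((tendsto_const_div_atTop_nhds_zero_nat ℓ).sqrt).const_mul M
      simpa using h
    refine squeeze_zero' (.of_forall fun _ => norm_nonneg _) ?_ hlim
    filter_upwards [Filter.eventually_gt_atTop 0] with n hn
    have hn' : (0 : ℝ) < n := by exact_mod_cast hn
    have hh : 0 < ℓ / n := by positivity
    refine ContinuousLinearMap.opNorm_le_bound _ (by positivity) fun f => ?_
    rw [mul_assoc]
    refine Lp.norm_le_of_ae_bound (by positivity) ?_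
    rw [_root_.sub_apply]
    filter_upwards [Lp.coeFn_sub (stepVolterra ℓ n f) (volterra ℓ f), stepVolterra_ae_eq hℓ hn f,
      volterra_ae_eq f, ae_restrict_mem measurableSet_Ioo] with x h1 h2 h3 hx
    have hle := (le_div_iff₀ hh).1 (Nat.floor_le (div_nonneg hx.1.le hh.le))
    have hlt := (div_lt_iff₀ hh).1 (Nat.lt_floor_add_one (x / (ℓ / n)))
    rw [h1, Pi.sub_apply, h2, h3, Real.norm_eq_abs, abs_sub_comm]
    refine (abs_primitive_sub_le f hle).trans ?_
    gcongr
    linarith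
  · refine .of_forall fun n => isCompactOperator_sum _ _ fun i _ => isCompactOperator_smulRight _ _

/-! ### Weak derivatives and boundary values -/

theorem absolutelyContinuous_of_contDiff {φ : ℝ → ℝ} (hφ : ContDiff ℝ ∞ φ) (a b : ℝ) :
    AbsolutelyContinuousOnInterval φ a b :=
  ((hφ.of_le (by exact_mod_cast le_top)).contDiffOn).absolutelyContinuousOnInterval

theorem hasWeakDeriv_volterra (hℓ : 0 < ℓ) (f : EdgeL2 ℓ) : HasWeakDeriv (volterra ℓ f) f := by
  intro φ h1 h2 h3
  have e := integral_primitive_mul_deriv hℓ.le f (absolutelyContinuous_of_contDiff h1 0 ℓ)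
    (φ' := deriv φ)
    (.of_forall fun x => (h1.differentiable (by simp)).differentiableAt.hasDerivAt)
  have hφ : φ ℓ = 0 := image_eq_zero_of_notMem_tsupport fun h => lt_irrefl _ (h3 h).2
  rw [integral_add (testIntegrable f h1.continuous h2)
    (testIntegrable _ (h1.continuous_deriv (by simp)) h2.deriv), hφ, mul_zero] at e
  linarith

theorem integral_zero_mul (φ : ℝ → ℝ) : ∫ x in Ioo 0 ℓ, (0 : EdgeL2 ℓ) x * φ x = 0 := by
  apply integral_eq_zero_of_ae
  filter_upwards [Lp.coeFn_zero ℝ 2 (volume.restrict (Ioo (0 : ℝ) ℓ))] with x hx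
  rw [hx, Pi.zero_apply]
  exact zero_mul _

theorem hasWeakDeriv_one : HasWeakDeriv (one ℓ) 0 := by
  intro φ h1 h2 h3
  have hsupp : tsupport (deriv φ) ⊆ Ioo 0 ℓ := tsupport_deriv_subset.trans h3
  have e1 : ∫ x in Ioo 0 ℓ, one ℓ x * deriv φ x = ∫ x in Ioo 0 ℓ, deriv φ x := by
    apply integral_congr_ae
    filter_upwards [one_ae_eq ℓ] with x hx
    rw [hx, one_mul]
  rw [e1, integral_zero_mul, neg_zero, setIntegral_eq_integral_of_forall_compl_eq_zero fun x hx =>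
    image_eq_zero_of_notMem_tsupport fun h => hx (hsupp h)]
  exact integral_eq_zero_of_hasDerivAt_of_integrable
    (fun x => (h1.differentiable (by simp)).differentiableAt.hasDerivAt)
    ((h1.continuous_deriv (by simp)).integrable_of_hasCompactSupport h2.deriv)
    (h1.continuous.integrable_of_hasCompactSupport h2)

/-- A test function on `(0, ℓ)` with vanishing integral is the derivative of a test function. -/
theorem exists_test_antideriv {θ : ℝ → ℝ} (h1 : ContDiff ℝ ∞ θ)
    (h2 : HasCompactSupport θ) (h3 : tsupport θ ⊆ Ioo 0 ℓ) (h4 : ∫ x, θ x = 0) :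
    ∃ ψ : ℝ → ℝ, ContDiff ℝ ∞ ψ ∧ HasCompactSupport ψ ∧ tsupport ψ ⊆ Ioo 0 ℓ ∧ deriv ψ = θ := by
  rcases (tsupport θ).eq_empty_or_nonempty with hemp | hne
  · refine ⟨0, contDiff_const, HasCompactSupport.zero, by simp, ?_⟩
    rw [tsupport_eq_empty_iff.1 hemp]
    ext x
    simp
  obtain ⟨a, ha, hamin⟩ := h2.exists_isLeast hne
  obtain ⟨b, hb, hbmax⟩ := h2.exists_isGreatest hne
  have hθ0 : ∀ x, x ∉ Icc a b → θ x = 0 := fun x hx =>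
    image_eq_zero_of_notMem_tsupport fun h => hx ⟨hamin h, hbmax h⟩
  have hint : Integrable θ := h1.continuous.integrable_of_hasCompactSupport h2
  have hd : ∀ x, HasDerivAt (fun x => ∫ t in (0 : ℝ)..x, θ t) (θ x) x := fun x =>
    h1.continuous.integral_hasStrictDerivAt 0 x |>.hasDerivAt
  have hderiv : deriv (fun x => ∫ t in (0 : ℝ)..x, θ t) = θ := funext fun x => (hd x).deriv
  have hzero : ∀ x, x ∉ Icc a b → ∫ t in (0 : ℝ)..x, θ t = 0 := by
    intro x hx
    rcases lt_or_ge x a with hxa | hxa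
    · -- Both endpoints lie to the left of the support.
      rw [intervalIntegral.integral_congr (g := fun _ => 0), intervalIntegral.integral_zero]
      intro t ht
      refine hθ0 t fun hab => ?_
      rcases le_max_iff.1 ht.2 with h | h
      · exact absurd (hab.1.trans h) (not_le.2 (h3 ha).1)
      · exact absurd (hab.1.trans h) (not_le.2 hxa)
    · have hbx : b < x := not_le.1 fun h => hx ⟨hxa, h⟩
      rw [intervalIntegral.integral_eq_integral_of_support_subset, h4]
      intro t ht
      have : t ∈ Icc a b := by_contra fun h => ht (hθ0 t h)
      exact ⟨(h3 ha).1.trans_le this.1, this.2.trans hbx.le⟩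
  have hsub : tsupport (fun x => ∫ t in (0 : ℝ)..x, θ t) ⊆ Icc a b :=
    closure_minimal (fun x hx => by_contra fun h => hx (hzero x h)) isClosed_Icc
  refine ⟨fun x => ∫ t in (0 : ℝ)..x, θ t, ?_, ?_, ?_, hderiv⟩
  · exact contDiff_infty_iff_deriv.2 ⟨fun x => (hd x).differentiableAt, hderiv.symm.subst h1⟩
  · exact isCompact_Icc.of_isClosed_subset (isClosed_tsupport _) hsub
  · exact hsub.trans fun x hx => ⟨(h3 ha).1.trans_le hx.1, hx.2.trans_lt (h3 hb).2⟩

/-- **Du Bois-Reymond lemma**: an `L²` function with vanishing weak derivative is constant. -/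
theorem HasWeakDeriv.eq_const (hℓ : 0 < ℓ) {w : EdgeL2 ℓ} (hw : HasWeakDeriv w 0) :
    ∃ c : ℝ, w = c • one ℓ := by
  have hw0 : ∀ φ : ℝ → ℝ, ContDiff ℝ ∞ φ → HasCompactSupport φ → tsupport φ ⊆ Ioo 0 ℓ →
      ∫ x in Ioo 0 ℓ, w x * deriv φ x = 0 := by
    intro φ h1 h2 h3
    rw [hw φ h1 h2 h3, integral_zero_mul, neg_zero]
  let B : ContDiffBump (ℓ / 2) := ⟨ℓ / 8, ℓ / 4, by positivity, by linarith⟩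
  set η : ℝ → ℝ := B.normed volume with hη
  have hη1 : ContDiff ℝ ∞ η := B.contDiff_normed
  have hη2 : HasCompactSupport η := B.hasCompactSupport_normed
  have hη3 : tsupport η ⊆ Ioo 0 ℓ := by
    rw [hη, B.tsupport_normed_eq, Real.closedBall_eq_Icc]
    change Icc (ℓ / 2 - ℓ / 4) (ℓ / 2 + ℓ / 4) ⊆ Ioo 0 ℓ
    exact fun x hx => ⟨by linarith [hx.1], by linarith [hx.2]⟩
  have hη4 : ∫ x, η x = 1 := B.integral_normed
  set c : ℝ := ∫ x in Ioo 0 ℓ, w x * η x with hc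
  refine ⟨c, ?_⟩
  have key : ∀ᵐ x ∂(volume : Measure ℝ), x ∈ Ioo 0 ℓ → w x - c = 0 := by
    apply isOpen_Ioo.ae_eq_zero_of_integral_contDiff_smul_eq_zero
    · have h1 : IntegrableOn (fun x => w x - c) (Ioo 0 ℓ) volume :=
        ((Lp.memLp w).integrable (by norm_num)).sub (integrable_const c)
      exact h1.locallyIntegrableOn
    · intro φ h1 h2 h3
      have i1 : Integrable φ := h1.continuous.integrable_of_hasCompactSupport h2
      have i2 : Integrable η := hη1.continuous.integrable_of_hasCompactSupport hη2
      have hsupp : tsupport (fun x => φ x - (∫ t, φ t) * η x) ⊆ Ioo 0 ℓ := by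
        refine (tsupport_sub φ (fun x => (∫ t, φ t) * η x)).trans (union_subset h3 ?_)
        exact (tsupport_mul_subset_right).trans hη3
      -- Subtracting `(∫ φ) η` from `φ` leaves a test function of vanishing integral, hence the
      -- derivative of a test function, to which the hypothesis on `w` applies.
      obtain ⟨ψ, p1, p2, p3, p4⟩ := exists_test_antideriv (ℓ := ℓ)
        (θ := fun x => φ x - (∫ t, φ t) * η x) (h1.sub (contDiff_const.mul hη1))
        (h2.sub hη2.mul_left) hsupp (by
          rw [integral_sub i1 (i2.const_mul _), integral_const_mul, hη4, mul_one, sub_self])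
      have e := hw0 ψ p1 p2 p3
      rw [p4] at e
      have e1 : ∫ x in Ioo 0 ℓ, w x * (φ x - (∫ t, φ t) * η x) =
          (∫ x in Ioo 0 ℓ, w x * φ x) - (∫ t, φ t) * c := by
        rw [hc, ← integral_const_mul, ← integral_sub (testIntegrable w h1.continuous h2)
          ((testIntegrable w hη1.continuous hη2).const_mul _)]
        congr 1 with x
        ring
      have e2 : ∫ x in Ioo 0 ℓ, φ x = ∫ x, φ x :=
        setIntegral_eq_integral_of_forall_compl_eq_zero fun x hx =>
          image_eq_zero_of_notMem_tsupport fun h => hx (h3 h)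
      rw [← setIntegral_eq_integral_of_forall_compl_eq_zero (s := Ioo 0 ℓ)]
      · have e3 : ∫ x in Ioo 0 ℓ, φ x • (w x - c) =
            (∫ x in Ioo 0 ℓ, w x * φ x) - c * ∫ x in Ioo 0 ℓ, φ x := by
          rw [← integral_const_mul, ← integral_sub (testIntegrable w h1.continuous h2)
            (i1.restrict.const_mul _)]
          congr 1 with x
          rw [smul_eq_mul]
          ring
        rw [e3, e2]
        linarith
      · intro x hx
        rw [image_eq_zero_of_notMem_tsupport fun h => hx (h3 h), zero_smul]
  apply Lp.ext
  filter_upwards [(ae_restrict_iff' measurableSet_Ioo).2 key, Lp.coeFn_smul c (one ℓ),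
    one_ae_eq ℓ] with x h1 h2 h3
  rw [h2, Pi.smul_apply, h3, smul_eq_mul]
  linarith

/-- Every `u ∈ H¹(0, ℓ)` is, up to an additive constant, the primitive of its weak derivative. -/
theorem HasWeakDeriv.eq_volterra_add (hℓ : 0 < ℓ) {u g : EdgeL2 ℓ} (h : HasWeakDeriv u g) :
    ∃ c : ℝ, u = volterra ℓ g + c • one ℓ := by
  have h' := h.add ((hasWeakDeriv_volterra hℓ g).smul (-1))
  rw [neg_one_smul, neg_one_smul, add_neg_cancel] at h'
  obtain ⟨c, hc⟩ := h'.eq_const hℓ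
  exact ⟨c, by rw [← hc]; abel⟩

theorem hasValueAt_volterra (f : EdgeL2 ℓ) (x : ℝ) :
    HasValueAt (volterra ℓ f) x (primitive f x) :=
  ⟨primitive f, (continuous_primitive f).continuousOn, volterra_ae_eq f, rfl⟩

theorem hasValueAt_one (x : ℝ) : HasValueAt (one ℓ) x 1 :=
  ⟨fun _ => 1, continuousOn_const, one_ae_eq ℓ, rfl⟩

theorem HasValueAt.unique (hℓ : 0 < ℓ) {u : EdgeL2 ℓ} {x c d : ℝ} (hx : x ∈ Icc 0 ℓ)
    (hc : HasValueAt u x c) (hd : HasValueAt u x d) : c = d := by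
  obtain ⟨v, hv, huv, rfl⟩ := hc
  obtain ⟨w, hw, huw, rfl⟩ := hd
  refine Measure.eqOn_Icc_of_ae_eq volume hℓ.ne ?_ hv hw hx
  rw [← restrict_Ioo_eq_restrict_Icc]
  exact huv.symm.trans huw

/-- Integration by parts for `u, v ∈ H¹(0, ℓ)` with `v(0) = 0`. -/
theorem inner_weakDeriv_add (hℓ : 0 < ℓ) {u u' v v' : EdgeL2 ℓ} {a b : ℝ}
    (hu : HasWeakDeriv u u') (hv : HasWeakDeriv v v') (hv0 : HasValueAt v 0 0)
    (hua : HasValueAt u ℓ a) (hvb : HasValueAt v ℓ b) :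
    inner ℝ u' v + inner ℝ u v' = a * b := by
  obtain ⟨c, rfl⟩ := hu.eq_volterra_add hℓ
  obtain ⟨d, rfl⟩ := hv.eq_volterra_add hℓ
  have hval : ∀ (f : EdgeL2 ℓ) (r x : ℝ),
      HasValueAt (volterra ℓ f + r • one ℓ) x (primitive f x + r * 1) := fun f r x =>
    (hasValueAt_volterra f x).add ((hasValueAt_one x).smul r)
  have e0 := hv0.unique hℓ ⟨le_rfl, hℓ.le⟩ (hval v' d 0)
  have e1 := hua.unique hℓ ⟨hℓ.le, le_rfl⟩ (hval u' c ℓ)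
  have e2 := hvb.unique hℓ ⟨hℓ.le, le_rfl⟩ (hval v' d ℓ)
  rw [primitive_zero_right] at e0
  obtain rfl : d = 0 := by linarith
  rw [e1, e2, inner_add_right, inner_add_left, inner_smul_left, inner_smul_right,
    inner_one_left hℓ.le, conj_trivial]
  have e3 := inner_volterra_add_inner_volterra hℓ.le u' v'
  linarith

end

/-! ### Symmetric operators with a resolvent -/

section
variable {E : Type*} [NormedAddCommGroup E] [InnerProductSpace ℝ E]

/-- A symmetric operator `A` such that `A - μ` is surjective for some real `μ` is self-adjoint.
In particular its domain is dense. -/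
theorem isSelfAdjoint_of_symmetric_of_surjective [CompleteSpace E] {A : E →ₗ.[ℝ] E}
    (hA : A.IsFormalAdjoint A) (μ : ℝ)
    (hsurj : ∀ f : E, ∃ u : A.domain, A u - μ • (u : E) = f) : IsSelfAdjoint A := by
  have hsym : ∀ x y : A.domain,
      inner ℝ (A x - μ • (x : E)) (y : E) = inner ℝ (x : E) (A y - μ • (y : E)) := by
    intro x y
    rw [inner_sub_left, inner_sub_right, hA x y, inner_smul_left, inner_smul_right, conj_trivial]
  have hdense : Dense (A.domain : Set E) := by
    rw [Submodule.dense_iff_topologicalClosure_eq_top, Submodule.topologicalClosure_eq_top_iff,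
      Submodule.eq_bot_iff]
    intro z hz
    obtain ⟨u, hu⟩ := hsurj z
    have hu0 : (u : E) = 0 := by
      obtain ⟨x, hx⟩ := hsurj u
      have h := hsym x u
      rwa [hx, hu, (Submodule.mem_orthogonal _ z).1 hz x x.2, inner_self_eq_zero] at h
    rw [← hu, show u = 0 from Subtype.ext hu0, A.map_zero, ZeroMemClass.coe_zero, smul_zero,
      sub_zero]
  have hle : A ≤ A.adjoint := LinearPMap.IsFormalAdjoint.le_adjoint hdense hA
  rw [LinearPMap.isSelfAdjoint_def]
  refine (LinearPMap.eq_of_le_of_domain_eq hle (le_antisymm hle.1 fun y hy => ?_)).symm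
  -- For `u` with `(A - μ) u = (A* - μ) y`, the difference `y - u` is orthogonal to the range of
  -- `A - μ`, that is, to everything.
  obtain ⟨u, hu⟩ := hsurj (A.adjoint ⟨y, hy⟩ - μ • y)
  have horth : ∀ x : A.domain, inner ℝ (A x - μ • (x : E)) (y - u) = 0 := by
    intro x
    have h1 := LinearPMap.adjoint_isFormalAdjoint hdense ⟨y, hy⟩ x
    rw [inner_sub_right, hsym x u, hu, inner_sub_left, inner_sub_right, inner_smul_left,
      inner_smul_right, conj_trivial, real_inner_comm y (A x), ← h1,
      real_inner_comm (x : E) (A.adjoint ⟨y, hy⟩)]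
    ring
  obtain ⟨x, hx⟩ := hsurj (y - u)
  have h0 := horth x
  rw [hx, inner_self_eq_zero, sub_eq_zero] at h0
  rw [h0]
  exact u.2

/-- For a symmetric operator `A`, a bounded right inverse of `A - μ` is a two-sided inverse. -/
theorem isResolventAt_of_symmetric {A : E →ₗ.[ℝ] E} (hA : A.IsFormalAdjoint A) {μ : ℝ}
    {R : E →L[ℝ] E} (hR : ∀ f : E, ∃ h : R f ∈ A.domain, A ⟨R f, h⟩ - μ • R f = f) :
    IsResolventAt A μ R := by
  refine ⟨hR, fun u => ?_⟩
  obtain ⟨h, e⟩ := hR (A u - μ • (u : E))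
  obtain ⟨h', e'⟩ := hR (R (A u - μ • (u : E)) - u)
  set v := R (A u - μ • (u : E))
  -- `v - u` lies in the kernel of `A - μ`, which is orthogonal to the range.
  have e1 := hA ⟨_, h'⟩ (⟨v, h⟩ - u)
  have e2 : A (⟨v, h⟩ - u) = μ • (v - u) := by
    rw [A.map_sub, smul_sub]
    exact sub_eq_sub_iff_sub_eq_sub.2 e
  rw [eq_add_of_sub_eq e', e2, inner_add_left, inner_smul_left, inner_smul_right] at e1
  rw [← sub_eq_zero, ← inner_self_eq_zero (𝕜 := ℝ)]
  change inner ℝ (v - (u : E)) (v - u) + μ * inner ℝ (R (v - u)) (v - (u : E)) =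
    μ * inner ℝ (R (v - u)) (v - (u : E)) at e1
  linarith

/-- By the resolvent identity, all resolvents are compact as soon as one of them is. -/
theorem IsResolventAt.isCompactOperator {A : E →ₗ.[ℝ] E} {μ ν : ℝ} {R S : E →L[ℝ] E}
    (hR : IsResolventAt A μ R) (hRc : IsCompactOperator R) (hS : IsResolventAt A ν S) :
    IsCompactOperator S := by
  have h : S = R + (ν - μ) • R.comp S := by
    ext f
    obtain ⟨hf, e⟩ := hS.1 f
    have h1 := hR.2 ⟨S f, hf⟩
    have h2 : A ⟨S f, hf⟩ - μ • S f = f + (ν - μ) • S f := by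
      rw [eq_add_of_sub_eq e]
      module
    rw [h2, map_add, map_smul] at h1
    exact h1.symm
  rw [h]
  exact hRc.add ((hRc.comp_clm S).smul _)

end

/-! ### Symmetry of the star graph operator -/

/-- The bilinear form of the operator: the boundary terms of the integrations by parts on the edges
cancel by the vertex conditions. -/
theorem inner_starOperator {N : ℕ} {L : Fin N → ℝ} (hL : ∀ j, 0 < L j) (k : Fin N → ℝ)
    (ψ φ : (starOperator L k).domain) :
    inner ℝ (starOperator L k ψ) (φ : GraphL2 L) =
      ∑ j, k j * inner ℝ (weakDeriv ((ψ : GraphL2 L) j)) (weakDeriv ((φ : GraphL2 L) j)) := by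
  obtain ⟨d, hd, hsum⟩ := ψ.2.2.2.2
  obtain ⟨c, hc⟩ := φ.2.2.2.1
  have h : ∀ j, inner ℝ (starOperator L k ψ j) ((φ : GraphL2 L) j) =
      k j * inner ℝ (weakDeriv ((ψ : GraphL2 L) j)) (weakDeriv ((φ : GraphL2 L) j))
        - c * (k j * d j) := by
    intro j
    have e := inner_weakDeriv_add (hL j) (ψ.2.1 j).2.hasWeakDeriv (φ.2.1 j).1.hasWeakDeriv
      (φ.2.2.1 j) (hd j) (hc j)
    change inner ℝ (-(k j) • weakDeriv (weakDeriv ((ψ : GraphL2 L) j))) _ = _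
    rw [inner_smul_left, conj_trivial]
    linear_combination (-(k j)) * e
  rw [PiLp.inner_apply, Finset.sum_congr rfl fun j _ => h j, Finset.sum_sub_distrib,
    ← Finset.mul_sum, hsum, mul_zero, sub_zero]

theorem isFormalAdjoint_starOperator {N : ℕ} {L : Fin N → ℝ} (hL : ∀ j, 0 < L j)
    (k : Fin N → ℝ) : (starOperator L k).IsFormalAdjoint (starOperator L k) := by
  intro ψ φ
  rw [inner_starOperator hL, real_inner_comm, inner_starOperator hL]
  simp_rw [real_inner_comm]

/-! ### The Green operator with decoupled Dirichlet conditions -/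

/-- The inverse of `-κ ∂ₓ²` on `(0, ℓ)` with Dirichlet conditions at both ends. -/
def edgeGreen (ℓ κ : ℝ) : EdgeL2 ℓ →L[ℝ] EdgeL2 ℓ :=
  κ⁻¹ • (((ℓ⁻¹ • (innerSL ℝ (one ℓ)).comp (volterra ℓ)).smulRight (volterra ℓ (one ℓ)))
    + (-1 : ℝ) • (volterra ℓ).comp (volterra ℓ))

section
variable {ℓ : ℝ}

theorem edgeGreen_apply (hℓ : 0 < ℓ) (κ : ℝ) (f : EdgeL2 ℓ) :
    edgeGreen ℓ κ f = κ⁻¹ • ((ℓ⁻¹ * primitive (volterra ℓ f) ℓ) • volterra ℓ (one ℓ)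
      + (-1 : ℝ) • volterra ℓ (volterra ℓ f)) := by
  rw [← inner_one_left hℓ.le]
  rfl

theorem hasWeakDeriv_edgeGreen (hℓ : 0 < ℓ) (κ : ℝ) (f : EdgeL2 ℓ) :
    HasWeakDeriv (edgeGreen ℓ κ f)
      (κ⁻¹ • ((ℓ⁻¹ * primitive (volterra ℓ f) ℓ) • one ℓ + (-1 : ℝ) • volterra ℓ f)) := by
  rw [edgeGreen_apply hℓ]
  exact (((hasWeakDeriv_volterra hℓ _).smul _).add ((hasWeakDeriv_volterra hℓ _).smul _)).smul _

theorem hasWeakDeriv_deriv_edgeGreen (hℓ : 0 < ℓ) (κ : ℝ) (f : EdgeL2 ℓ) :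
    HasWeakDeriv
      (κ⁻¹ • ((ℓ⁻¹ * primitive (volterra ℓ f) ℓ) • one ℓ + (-1 : ℝ) • volterra ℓ f))
      (-κ⁻¹ • f) := by
  have h := ((hasWeakDeriv_one.smul (ℓ⁻¹ * primitive (volterra ℓ f) ℓ)).add
    ((hasWeakDeriv_volterra hℓ f).smul (-1))).smul κ⁻¹
  convert h using 1
  module

theorem hasValueAt_edgeGreen_left (hℓ : 0 < ℓ) (κ : ℝ) (f : EdgeL2 ℓ) :
    HasValueAt (edgeGreen ℓ κ f) 0 0 := by
  have h := ((((hasValueAt_volterra (one ℓ) 0).smul (ℓ⁻¹ * primitive (volterra ℓ f) ℓ)).add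
    ((hasValueAt_volterra (volterra ℓ f) 0).smul (-1))).smul κ⁻¹)
  rw [edgeGreen_apply hℓ]
  simpa using h

theorem hasValueAt_edgeGreen_right (hℓ : 0 < ℓ) (κ : ℝ) (f : EdgeL2 ℓ) :
    HasValueAt (edgeGreen ℓ κ f) ℓ 0 := by
  have h := ((((hasValueAt_volterra (one ℓ) ℓ).smul (ℓ⁻¹ * primitive (volterra ℓ f) ℓ)).add
    ((hasValueAt_volterra (volterra ℓ f) ℓ).smul (-1))).smul κ⁻¹)
  rw [edgeGreen_apply hℓ]
  convert h using 1
  rw [primitive_one ⟨hℓ.le, le_rfl⟩]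
  field_simp
  ring

theorem hasValueAt_deriv_edgeGreen_right (κ : ℝ) (f : EdgeL2 ℓ) :
    HasValueAt (κ⁻¹ • ((ℓ⁻¹ * primitive (volterra ℓ f) ℓ) • one ℓ + (-1 : ℝ) • volterra ℓ f)) ℓ
      (κ⁻¹ * (ℓ⁻¹ * primitive (volterra ℓ f) ℓ - primitive f ℓ)) := by
  have h := (((hasValueAt_one (ℓ := ℓ) ℓ).smul (ℓ⁻¹ * primitive (volterra ℓ f) ℓ)).add
    ((hasValueAt_volterra f ℓ).smul (-1))).smul κ⁻¹
  convert h using 1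
  ring

theorem isCompactOperator_edgeGreen (hℓ : 0 < ℓ) (κ : ℝ) : IsCompactOperator (edgeGreen ℓ κ) :=
  ((isCompactOperator_smulRight (ℓ⁻¹ • (innerSL ℝ (one ℓ)).comp (volterra ℓ)) _).add
    (((isCompactOperator_volterra hℓ).comp_clm (volterra ℓ)).smul (-1 : ℝ))).smul κ⁻¹

end

section
variable {N : ℕ} (L k : Fin N → ℝ)

/-- The Green operator of the edges decoupled by Dirichlet conditions at the internal vertex. -/
def graphGreen : GraphL2 L →L[ℝ] GraphL2 L :=
  ∑ j, (((PiLp.continuousLinearEquiv 2 ℝ fun j => EdgeL2 (L j)).symm :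
      (∀ j, EdgeL2 (L j)) →L[ℝ] GraphL2 L).comp
        (ContinuousLinearMap.single ℝ (fun j => EdgeL2 (L j)) j)).comp
    ((edgeGreen (L j) (k j)).comp (PiLp.proj 2 (fun j => EdgeL2 (L j)) j))

/-- The function that is linear on each edge, with value `0` at the external vertices and `1` at
the internal vertex. -/
def hat : GraphL2 L := WithLp.toLp 2 fun j => (L j)⁻¹ • volterra (L j) (one (L j))

/-- The functional `f ↦ ∑ⱼ ∫₀^{Lⱼ} (x / Lⱼ) fⱼ(x) dx`. By Green's formula it is minus the total flux
`∑ⱼ kⱼ uⱼ'(Lⱼ)` of `u = graphGreen L k f` at the internal vertex. -/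
def flux : GraphL2 L →L[ℝ] ℝ :=
  ∑ j, ((innerSL ℝ (one (L j))).comp
    (ContinuousLinearMap.id ℝ (EdgeL2 (L j)) - (L j)⁻¹ • volterra (L j))).comp
      (PiLp.proj 2 (fun j => EdgeL2 (L j)) j)

variable {L}

theorem graphGreen_apply (f : GraphL2 L) (j : Fin N) :
    graphGreen L k f j = edgeGreen (L j) (k j) (f j) := by
  rw [graphGreen, _root_.sum_apply, WithLp.ofLp_sum, Finset.sum_apply, Finset.sum_eq_single j]
  · exact Pi.single_eq_same _ _
  · intro i _ hij
    exact Pi.single_eq_of_ne hij.symm _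
  · intro h
    exact absurd (Finset.mem_univ j) h

theorem flux_apply (hL : ∀ j, 0 < L j) (f : GraphL2 L) :
    flux L f = ∑ j, (primitive (f j) (L j) - (L j)⁻¹ * primitive (volterra (L j) (f j)) (L j)) := by
  rw [flux, _root_.sum_apply]
  refine Finset.sum_congr rfl fun j _ => ?_
  rw [← inner_one_left (hL j).le, ← inner_one_left (hL j).le, ← inner_smul_right,
    ← inner_sub_right]
  rfl

theorem isCompactOperator_graphGreen (hL : ∀ j, 0 < L j) : IsCompactOperator (graphGreen L k) :=
  isCompactOperator_sum _ _ fun j _ =>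
    ((isCompactOperator_edgeGreen (hL j) (k j)).comp_clm
      (PiLp.proj 2 (fun j => EdgeL2 (L j)) j)).clm_comp
        (((PiLp.continuousLinearEquiv 2 ℝ fun j => EdgeL2 (L j)).symm :
          (∀ j, EdgeL2 (L j)) →L[ℝ] GraphL2 L).comp
            (ContinuousLinearMap.single ℝ (fun j => EdgeL2 (L j)) j))

theorem flux_hat (hL : ∀ j, 0 < L j) : flux L (hat L) = ∑ j, L j / 3 := by
  rw [flux_apply hL]
  refine Finset.sum_congr rfl fun j _ => ?_
  have h0 := (hL j).ne'
  have hj : L j ∈ Icc 0 (L j) := ⟨(hL j).le, le_rfl⟩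
  change primitive ((L j)⁻¹ • volterra (L j) (one (L j))) (L j) -
    (L j)⁻¹ * primitive (volterra (L j) ((L j)⁻¹ • volterra (L j) (one (L j)))) (L j) = _
  rw [map_smul, primitive_smul, primitive_smul, primitive_volterra_one hj,
    primitive_volterra_volterra_one hj]
  field_simp
  ring

/-- The solution of `-kⱼ uⱼ'' = gⱼ` with value `c` at the internal vertex satisfies the flux
condition, hence belongs to the operator domain, if `c (∑ⱼ kⱼ / Lⱼ) = flux g`. -/
theorem starOperator_graphGreen_add (hL : ∀ j, 0 < L j) (hk : ∀ j, k j ≠ 0) (g : GraphL2 L)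
    (c : ℝ) (hc : c * ∑ j, k j / L j = flux L g) :
    ∃ h : graphGreen L k g + c • hat L ∈ (starOperator L k).domain,
      starOperator L k ⟨_, h⟩ = g := by
  set u := graphGreen L k g + c • hat L
  have hu : ∀ j, u j = edgeGreen (L j) (k j) (g j) +
      c • (L j)⁻¹ • volterra (L j) (one (L j)) := fun j => by
    rw [← graphGreen_apply]
    rfl
  have hu1 : ∀ j, HasWeakDeriv (u j) _ := fun j => by
    rw [hu j]
    exact (hasWeakDeriv_edgeGreen (hL j) (k j) (g j)).add
      (((hasWeakDeriv_volterra (hL j) (one (L j))).smul (L j)⁻¹).smul c)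
  have hu2 : ∀ j, HasWeakDeriv (weakDeriv (u j)) (-(k j)⁻¹ • g j) := fun j => by
    rw [(hu1 j).weakDeriv_eq]
    have h := (hasWeakDeriv_deriv_edgeGreen (hL j) (k j) (g j)).add
      ((hasWeakDeriv_one.smul (L j)⁻¹).smul c)
    rwa [smul_zero, smul_zero, add_zero] at h
  have hmem : u ∈ (starOperator L k).domain := by
    refine ⟨fun j => ⟨(hu1 j).memH1, (hu2 j).memH1⟩, fun j => ?_, ⟨c, fun j => ?_⟩,
      fun j => (k j)⁻¹ * ((L j)⁻¹ * primitive (volterra (L j) (g j)) (L j) -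
        primitive (g j) (L j)) + c * ((L j)⁻¹ * 1), fun j => ?_, ?_⟩
    · have h := (hasValueAt_edgeGreen_left (hL j) (k j) (g j)).add
        (((hasValueAt_volterra (one (L j)) 0).smul (L j)⁻¹).smul c)
      rw [← hu j] at h
      simpa using h
    · have h := (hasValueAt_edgeGreen_right (hL j) (k j) (g j)).add
        (((hasValueAt_volterra (one (L j)) (L j)).smul (L j)⁻¹).smul c)
      rw [← hu j, primitive_one ⟨(hL j).le, le_rfl⟩, inv_mul_cancel₀ (hL j).ne'] at h
      simpa using h
    · rw [(hu1 j).weakDeriv_eq]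
      exact (hasValueAt_deriv_edgeGreen_right (k j) (g j)).add
        (((hasValueAt_one (L j)).smul (L j)⁻¹).smul c)
    · rw [flux_apply hL, Finset.mul_sum, ← sub_eq_zero, ← Finset.sum_sub_distrib] at hc
      refine Eq.trans ?_ hc
      refine Finset.sum_congr rfl fun j _ => ?_
      have := hk j
      have := (hL j).ne'
      field_simp
      ring
  refine ⟨hmem, ?_⟩
  ext1 j
  change -(k j) • weakDeriv (weakDeriv (u j)) = g j
  rw [(hu2 j).weakDeriv_eq, smul_smul, neg_mul_neg, mul_inv_cancel₀ (hk j), one_smul]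

/-! ### The resolvent -/

/-- The vertex value of the solution of `(A - μ) u = f` is determined by a scalar equation with
coefficient `∑ⱼ kⱼ / Lⱼ - μ flux ((1 - μ G)⁻¹ hat)`, where `G = graphGreen L k`. Some `μ` makes it
nonzero: `μ = 0` unless `∑ⱼ kⱼ / Lⱼ = 0`, and every small `μ ≠ 0` in that case, as
`flux hat > 0`. -/
theorem exists_neumann_inverse (hN : 0 < N) (hL : ∀ j, 0 < L j) :
    ∃ (μ : ℝ) (S : GraphL2 L →L[ℝ] GraphL2 L),
      (∀ f, S f - μ • graphGreen L k (S f) = f) ∧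
        ∑ j, k j / L j - μ * flux L (S (hat L)) ≠ 0 := by
  by_cases hσ : ∑ j, k j / L j = 0
  · have hpos : flux L (hat L) ≠ 0 := by
      have : Nonempty (Fin N) := ⟨⟨0, hN⟩⟩
      rw [flux_hat hL]
      exact (Finset.sum_pos (fun j _ => div_pos (hL j) three_pos) Finset.univ_nonempty).ne'
    set T : ℝ → (GraphL2 L →L[ℝ] GraphL2 L) := fun μ => 1 - μ • graphGreen L k with hT
    have hT0 : T 0 = ((1 : (GraphL2 L →L[ℝ] GraphL2 L)ˣ) : GraphL2 L →L[ℝ] GraphL2 L) := by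
      rw [hT, Units.val_one]
      exact (congrArg (1 - ·) (zero_smul ℝ (graphGreen L k))).trans (sub_zero _)
    have hTc : ContinuousAt T 0 := by
      rw [hT]
      fun_prop
    have hinv : ContinuousAt (fun μ => flux L (Ring.inverse (T μ) (hat L))) 0 := by
      have h1 : ContinuousAt Ring.inverse (T 0) := by
        rw [hT0]
        exact NormedRing.inverse_continuousAt _
      have h2 : ContinuousAt (fun μ => Ring.inverse (T μ)) 0 := ContinuousAt.comp h1 hTc
      exact (flux L).continuous.continuousAt.comp (h2.clm_apply continuousAt_const)
    have h0 : flux L (Ring.inverse (T 0) (hat L)) ≠ 0 := by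
      rw [hT0, Ring.inverse_unit]
      simpa using hpos
    have hunit : ∀ᶠ μ in nhds (0 : ℝ), IsUnit (T μ) :=
      hTc.eventually (Units.isOpen.mem_nhds (by rw [hT0]; exact Units.isUnit _))
    have hev : ∀ᶠ μ in nhdsWithin (0 : ℝ) {0}ᶜ,
        (IsUnit (T μ) ∧ flux L (Ring.inverse (T μ) (hat L)) ≠ 0) ∧ μ ∈ ({0}ᶜ : Set ℝ) :=
      ((hunit.and (hinv.eventually_ne h0)).filter_mono nhdsWithin_le_nhds).and
        self_mem_nhdsWithin
    obtain ⟨μ, ⟨h1, h2⟩, hμ⟩ := hev.exists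
    refine ⟨μ, Ring.inverse (T μ), fun f => ?_, ?_⟩
    · exact congrArg (fun B : GraphL2 L →L[ℝ] GraphL2 L => B f) (Ring.mul_inverse_cancel _ h1)
    · rw [hσ, zero_sub]
      exact neg_ne_zero.2 (mul_ne_zero hμ h2)
  · exact ⟨0, ContinuousLinearMap.id ℝ _, fun f => by simp, by simpa using hσ⟩

theorem exists_compact_resolvent (hN : 0 < N) (hL : ∀ j, 0 < L j) (hk : ∀ j, k j ≠ 0) :
    ∃ (μ : ℝ) (R : GraphL2 L →L[ℝ] GraphL2 L),
      IsResolventAt (starOperator L k) μ R ∧ IsCompactOperator R := by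
  obtain ⟨μ, S, hS, hm⟩ := exists_neumann_inverse k hN hL
  set m := ∑ j, k j / L j - μ * flux L (S (hat L)) with hmdef
  -- The vertex value of the solution as a functional of the right-hand side.
  let c : GraphL2 L →L[ℝ] ℝ := m⁻¹ • (flux L).comp S
  let R : GraphL2 L →L[ℝ] GraphL2 L :=
    (graphGreen L k).comp (S + (μ • c).smulRight (S (hat L))) + c.smulRight (hat L)
  refine ⟨μ, R, isResolventAt_of_symmetric (isFormalAdjoint_starOperator hL k) fun f => ?_,
    ((isCompactOperator_graphGreen k hL).comp_clm _).add (isCompactOperator_smulRight _ _)⟩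
  set g := S f + (μ * c f) • S (hat L) with hg
  have hcf : m * c f = flux L (S f) := by
    change m * (m⁻¹ * flux L (S f)) = _
    rw [mul_inv_cancel_left₀ hm]
  obtain ⟨hmem, he⟩ := starOperator_graphGreen_add k hL hk g (c f) (by
    rw [hg, map_add, map_smul, smul_eq_mul, ← hcf, hmdef]
    ring)
  refine ⟨hmem, ?_⟩
  change starOperator L k ⟨_, hmem⟩ - μ • (graphGreen L k g + c f • hat L) = f
  rw [he]
  have h1 : g - μ • graphGreen L k g = f + (μ * c f) • hat L := by
    calc g - μ • graphGreen L k g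
        = (S f - μ • graphGreen L k (S f)) +
            (μ * c f) • (S (hat L) - μ • graphGreen L k (S (hat L))) := by
          rw [hg, map_add, map_smul]
          module
      _ = f + (μ * c f) • hat L := by rw [hS, hS]
  rw [smul_add, ← sub_sub, h1, smul_smul, add_sub_cancel_right]

end

end StarGraph

end

theorem mainTheorem9 (N D : ℕ) (hDN : D < N) (L : Fin N → ℝ) (hL : ∀ j, 0 < L j)
    (kneg : ℝ) (hk : kneg < 0) :
    IsSelfAdjoint (StarGraph.starOperator L (StarGraph.twoPhase N D kneg)) ∧
    (|kneg| ≠ (D : ℝ) / ((N : ℝ) - (D : ℝ)) →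
      StarGraph.HasCompactResolvent
        (StarGraph.starOperator L (StarGraph.twoPhase N D kneg))) := by
  have hk0 : ∀ j, StarGraph.twoPhase N D kneg j ≠ 0 := fun j => by
    unfold StarGraph.twoPhase
    split_ifs
    exacts [one_ne_zero, hk.ne]
  obtain ⟨μ, R, hR, hRc⟩ := StarGraph.exists_compact_resolvent (StarGraph.twoPhase N D kneg)
    (Nat.zero_lt_of_lt hDN) hL hk0
  refine ⟨StarGraph.isSelfAdjoint_of_symmetric_of_surjective
    (StarGraph.isFormalAdjoint_starOperator hL _) μ fun f => ?_,
    fun _ => ⟨⟨μ, R, hR⟩, fun _ _ hS => hR.isCompactOperator hRc hS⟩⟩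
  obtain ⟨h, e⟩ := hR.1 f
  exact ⟨⟨R f, h⟩, e⟩
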